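/- All $\mathrm{C}^*$-algebras and all $*$-homomorphisms below are unital, and $\otimes$ denotes the minimal tensor product of $\mathrm{C}^*$-algebras. A compact quantum space $\mathbb{X}$ is given by a unital $\mathrm{C}^*$-algebra, denoted $\mathrm{C}(\mathbb{X})$. A compact quantum semigroup is a compact quantum space $\mathbb{X}$ together with a $*$-homomorphism $\Delta\colon \mathrm{C}(\mathbb{X})\to \mathrm{C}(\mathbb{X})\otimes \mathrm{C}(\mathbb{X})$ that is coassociative, i.e. $(\Delta\otimes\mathrm{id})\circ\Delta=(\mathrm{id}\otimes\Delta)\circ\Delta$. **Theorem.** Let $K$ be a finite set, let $\mathrm{C}(K)$ be the $\mathrm{C}^*$-algebra of all complex functions on $K$, and let $\mathbb{S}$ be a compact quantum semigroup with comultiplication $\Delta_{\mathbb{S}}\colon \mathrm{C}(\mathbb{S})\to \mathrm{C}(\mathbb{S})\otimes \mathrm{C}(\mathbb{S})$. Let $\mathbb{H}$ be the quantum space of all maps $K\to\mathbb{S}$ and let $\Phi\colon \mathrm{C}(\mathbb{S})\to \mathrm{C}(K)\otimes \mathrm{C}(\mathbb{H})$ be the quantum family of all these maps; that is, for every unital $\mathrm{C}^*$-algebra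 $D$ and every $*$-homomorphism $\Psi\colon \mathrm{C}(\mathbb{S})\to \mathrm{C}(K)\otimes D$ there is a unique $*$-homomorphism $\Lambda\colon \mathrm{C}(\mathbb{H})\to D$ such that $(\mathrm{id}\otimes\Lambda)\circ\Phi=\Psi$. Then there is a unique $*$-homomorphism $\Delta_{\mathbb{H}}\colon \mathrm{C}(\mathbb{H})\to \mathrm{C}(\mathbb{H})\otimes \mathrm{C}(\mathbb{H})$ such that $$(\mathrm{id}\otimes\Delta_{\mathbb{H}})\circ\Phi=(\mu\otimes\mathrm{id}\otimes\mathrm{id})\circ(\mathrm{id}\otimes\sigma\otimes\mathrm{id})\circ(\Phi\otimes\Phi)\circ\Delta_{\mathbb{S}},$$ where $\sigma\colon \mathrm{C}(\mathbb{H})\otimes \mathrm{C}(K)\to \mathrm{C}(K)\otimes \mathrm{C}(\mathbb{H})$ is the flip and $\mu\colon \mathrm{C}(K)\otimes \mathrm{C}(K)\to \mathrm{C}(K)$ is the multiplication map. Moreover $\Delta_{\mathbb{H}}$ is coassociative, so that $\mathbb{H}$ with $\Delta_{\mathbb{H}}$ is a compact quantum semigroup. -/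

import Mathlib

open scoped TensorProduct InnerProductSpace

universe u

noncomputable section

namespace QuantumMaps

section HilbertTensor

variable {E F : Type*} [NormedAddCommGroup E] [InnerProductSpace ℂ E]
  [NormedAddCommGroup F] [InnerProductSpace ℂ F]

/-- The Hilbert space tensor product: the completion of the algebraic tensor product of two
inner product spaces. -/
def HilbertTensor (E F : Type*) [NormedAddCommGroup E] [InnerProductSpace ℂ E]
    [NormedAddCommGroup F] [InnerProductSpace ℂ F] : Type _ :=
  UniformSpace.Completion (E ⊗[ℂ] F)

instance : NormedAddCommGroup (HilbertTensor E F) :=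
  inferInstanceAs (NormedAddCommGroup (UniformSpace.Completion (E ⊗[ℂ] F)))

instance : InnerProductSpace ℂ (HilbertTensor E F) :=
  inferInstanceAs (InnerProductSpace ℂ (UniformSpace.Completion (E ⊗[ℂ] F)))

instance : CompleteSpace (HilbertTensor E F) :=
  inferInstanceAs (CompleteSpace (UniformSpace.Completion (E ⊗[ℂ] F)))

/-- The canonical isometric inclusion of the algebraic tensor product. -/
def HilbertTensor.of : E ⊗[ℂ] F →ₗᵢ[ℂ] HilbertTensor E F :=
  UniformSpace.Completion.toComplₗᵢ (𝕜 := ℂ) (E := E ⊗[ℂ] F)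

lemma HilbertTensor.denseRange_of :
    DenseRange (HilbertTensor.of : E ⊗[ℂ] F → HilbertTensor E F) :=
  UniformSpace.Completion.denseRange_coe

/-- The operator `S ⊗ T` on the Hilbert space tensor product. -/
def opTensor (S : E →L[ℂ] E) (T : F →L[ℂ] F) : HilbertTensor E F →L[ℂ] HilbertTensor E F :=
  (TensorProduct.mapL S T).completion

@[simp] lemma opTensor_of (S : E →L[ℂ] E) (T : F →L[ℂ] F) (x : E ⊗[ℂ] F) :
    opTensor S T (HilbertTensor.of x) =
      HilbertTensor.of (TensorProduct.map S.toLinearMap T.toLinearMap x) := by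
  rw [← TensorProduct.mapL_apply]
  exact ContinuousLinearMap.completion_apply_coe (TensorProduct.mapL S T) x

lemma clm_ext_of {W : Type*} [NormedAddCommGroup W] [NormedSpace ℂ W]
    {S T : HilbertTensor E F →L[ℂ] W}
    (h : ∀ x : E ⊗[ℂ] F, S (HilbertTensor.of x) = T (HilbertTensor.of x)) : S = T :=
  ContinuousLinearMap.coeFn_injective
    (HilbertTensor.denseRange_of.equalizer S.continuous T.continuous (funext h))

lemma opTensor_mul (S S' : E →L[ℂ] E) (T T' : F →L[ℂ] F) :
    opTensor (S * S') (T * T') = opTensor S T * opTensor S' T' := by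
  refine clm_ext_of fun x => ?_
  simp only [opTensor_of, mul_apply_eq_comp]
  congr 1
  exact congrFun (congrArg DFunLike.coe (TensorProduct.map_comp _ _ _ _)) x

lemma opTensor_one : opTensor (1 : E →L[ℂ] E) (1 : F →L[ℂ] F) = 1 := by
  refine clm_ext_of fun x => ?_
  simp only [opTensor_of, one_apply_eq_self]
  congr 1
  exact congrFun (congrArg DFunLike.coe TensorProduct.map_id) x

lemma norm_opTensor_le (S : E →L[ℂ] E) (T : F →L[ℂ] F) : ‖opTensor S T‖ ≤ ‖S‖ * ‖T‖ := by
  refine ContinuousLinearMap.opNorm_le_bound _ (by positivity) fun x => ?_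
  refine HilbertTensor.denseRange_of.induction_on
    (p := fun x => ‖opTensor S T x‖ ≤ ‖S‖ * ‖T‖ * ‖x‖) x
    (isClosed_le (by fun_prop) (by fun_prop)) fun x => ?_
  rw [opTensor_of, LinearIsometry.norm_map, LinearIsometry.norm_map, ← TensorProduct.mapL_apply]
  exact (ContinuousLinearMap.le_opNorm (TensorProduct.mapL S T) x).trans
    (mul_le_mul_of_nonneg_right (TensorProduct.norm_mapL_le S T) (norm_nonneg _))

lemma star_opTensor [CompleteSpace E] [CompleteSpace F] (S : E →L[ℂ] E) (T : F →L[ℂ] F) :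
    star (opTensor S T) = opTensor (star S) (star T) := by
  rw [ContinuousLinearMap.star_eq_adjoint, eq_comm, ContinuousLinearMap.eq_adjoint_iff]
  intro x y
  refine HilbertTensor.denseRange_of.induction_on₂
    (p := fun x y => ⟪opTensor (star S) (star T) x, y⟫_ℂ = ⟪x, opTensor S T y⟫_ℂ)
    (isClosed_eq (by fun_prop) (by fun_prop)) (fun x y => ?_) x y
  rw [opTensor_of, opTensor_of, LinearIsometry.inner_map_map, LinearIsometry.inner_map_map]
  induction x with
  | zero => simp
  | add a b ha hb => rw [map_add, inner_add_left, inner_add_left, ha, hb]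
  | tmul e f =>
    induction y with
    | zero => simp
    | add a b ha hb => rw [map_add, inner_add_right, inner_add_right, ha, hb]
    | tmul e' f' =>
      simp [TensorProduct.inner_tmul, ContinuousLinearMap.star_eq_adjoint,
        ContinuousLinearMap.adjoint_inner_left]

lemma opTensor_add_left (S S' : E →L[ℂ] E) (T : F →L[ℂ] F) :
    opTensor (S + S') T = opTensor S T + opTensor S' T := clm_ext_of fun x => by
  simp [TensorProduct.map_add_left]

lemma opTensor_add_right (S : E →L[ℂ] E) (T T' : F →L[ℂ] F) :
    opTensor S (T + T') = opTensor S T + opTensor S T' := clm_ext_of fun x => by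
  simp [TensorProduct.map_add_right]

lemma opTensor_smul_one (c : ℂ) :
    opTensor (c • (1 : E →L[ℂ] E)) (1 : F →L[ℂ] F) = c • 1 := by
  rw [← opTensor_one]
  refine clm_ext_of fun x => ?_
  simp [TensorProduct.map_smul_left]

lemma opTensor_one_smul (c : ℂ) :
    opTensor (1 : E →L[ℂ] E) (c • (1 : F →L[ℂ] F)) = c • 1 := by
  rw [← opTensor_one]
  refine clm_ext_of fun x => ?_
  simp [TensorProduct.map_smul_right]

/-- An operator is bounded by `c` as soon as its matrix coefficients on a dense set are. -/
lemma opNorm_le_of_dense {V H : Type*} [NormedAddCommGroup H] [InnerProductSpace ℂ H]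
    {J : V → H} (hJ : DenseRange J) (T : H →L[ℂ] H) {c : ℝ} (hc : 0 ≤ c)
    (h : ∀ v w, ‖⟪J v, T (J w)⟫_ℂ‖ ≤ c * ‖J v‖ * ‖J w‖) : ‖T‖ ≤ c := by
  have h2 : ∀ x y : H, ‖⟪x, T y⟫_ℂ‖ ≤ c * ‖x‖ * ‖y‖ := by
    intro x y
    refine hJ.induction_on₂ (p := fun x y => ‖⟪x, T y⟫_ℂ‖ ≤ c * ‖x‖ * ‖y‖) ?_ h x y
    exact isClosed_le (by fun_prop) (by fun_prop)
  refine ContinuousLinearMap.opNorm_le_bound _ hc fun y => ?_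
  have h3 := h2 (T y) y
  rw [inner_self_eq_norm_sq_to_K] at h3
  simp only [norm_pow, RCLike.norm_ofReal, abs_norm] at h3
  rcases (norm_nonneg (T y)).eq_or_lt with h0 | h0
  · rw [← h0]; positivity
  · nlinarith

end HilbertTensor

section Representations

variable {A B D : Type*} [CStarAlgebra A] [CStarAlgebra B] [CStarAlgebra D]
variable {E F : Type*} [NormedAddCommGroup E] [InnerProductSpace ℂ E] [CompleteSpace E]
  [NormedAddCommGroup F] [InnerProductSpace ℂ F] [CompleteSpace F]

/-- Two unital `*`-homomorphisms with commuting ranges, multiplied together, define a unital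
`*`-homomorphism on the algebraic tensor product. -/
def algLift (f : A →⋆ₐ[ℂ] D) (g : B →⋆ₐ[ℂ] D) (hfg : ∀ a b, Commute (f a) (g b)) :
    A ⊗[ℂ] B →⋆ₐ[ℂ] D where
  toAlgHom := Algebra.TensorProduct.lift f.toAlgHom g.toAlgHom hfg
  map_star' x := by
    change Algebra.TensorProduct.lift f.toAlgHom g.toAlgHom hfg (star x) =
      star (Algebra.TensorProduct.lift f.toAlgHom g.toAlgHom hfg x)
    induction x with
    | zero => simp
    | add a b ha hb => rw [star_add, map_add, map_add, star_add, ha, hb]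
    | tmul a b =>
      rw [TensorProduct.star_tmul, Algebra.TensorProduct.lift_tmul,
        Algebra.TensorProduct.lift_tmul, star_mul]
      change f (star a) * g (star b) = star (g b) * star (f a)
      rw [map_star f, map_star g]
      exact ((hfg a b).star_star).eq

@[simp] lemma algLift_tmul (f : A →⋆ₐ[ℂ] D) (g : B →⋆ₐ[ℂ] D) (hfg) (a : A) (b : B) :
    algLift f g hfg (a ⊗ₜ b) = f a * g b := rfl

/-- The representation `a ↦ π a ⊗ 1`. -/
def leftRep (F : Type*) [NormedAddCommGroup F] [InnerProductSpace ℂ F] [CompleteSpace F]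
    (π : A →⋆ₐ[ℂ] (E →L[ℂ] E)) :
    A →⋆ₐ[ℂ] (HilbertTensor E F →L[ℂ] HilbertTensor E F) where
  toFun a := opTensor (π a) 1
  map_one' := by rw [map_one, opTensor_one]
  map_mul' a b := by rw [map_mul, ← opTensor_mul, one_mul]
  map_zero' := by
    have h := opTensor_smul_one (E := E) (F := F) 0
    rwa [zero_smul, zero_smul, ← map_zero π] at h
  map_add' a b := by rw [map_add, opTensor_add_left]
  commutes' c := by
    rw [Algebra.algebraMap_eq_smul_one, map_smul, map_one, opTensor_smul_one,
      Algebra.algebraMap_eq_smul_one]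
  map_star' a := by rw [map_star, star_opTensor, star_one]

/-- The representation `b ↦ 1 ⊗ ρ b`. -/
def rightRep (E : Type*) [NormedAddCommGroup E] [InnerProductSpace ℂ E] [CompleteSpace E]
    (ρ : B →⋆ₐ[ℂ] (F →L[ℂ] F)) :
    B →⋆ₐ[ℂ] (HilbertTensor E F →L[ℂ] HilbertTensor E F) where
  toFun b := opTensor 1 (ρ b)
  map_one' := by rw [map_one, opTensor_one]
  map_mul' a b := by rw [map_mul, ← opTensor_mul, one_mul]
  map_zero' := by
    have h := opTensor_one_smul (E := E) (F := F) 0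
    rwa [zero_smul, zero_smul, ← map_zero ρ] at h
  map_add' a b := by rw [map_add, opTensor_add_right]
  commutes' c := by
    rw [Algebra.algebraMap_eq_smul_one, map_smul, map_one, opTensor_one_smul,
      Algebra.algebraMap_eq_smul_one]
  map_star' a := by rw [map_star, star_opTensor, star_one]

/-- The tensor product `π ⊗ ρ` of two representations, on the algebraic tensor product. -/
def repTensor (π : A →⋆ₐ[ℂ] (E →L[ℂ] E)) (ρ : B →⋆ₐ[ℂ] (F →L[ℂ] F)) :
    A ⊗[ℂ] B →⋆ₐ[ℂ] (HilbertTensor E F →L[ℂ] HilbertTensor E F) :=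
  algLift (leftRep F π) (rightRep E ρ) fun a b => by
    change opTensor (π a) 1 * opTensor 1 (ρ b) = opTensor 1 (ρ b) * opTensor (π a) 1
    rw [← opTensor_mul, ← opTensor_mul, one_mul, mul_one, one_mul, mul_one]

@[simp] lemma repTensor_tmul (π : A →⋆ₐ[ℂ] (E →L[ℂ] E)) (ρ : B →⋆ₐ[ℂ] (F →L[ℂ] F))
    (a : A) (b : B) : repTensor π ρ (a ⊗ₜ b) = opTensor (π a) (ρ b) := by
  change opTensor (π a) 1 * opTensor 1 (ρ b) = _
  rw [← opTensor_mul, one_mul, mul_one]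

lemma norm_starHom_le {A B : Type*} [CStarAlgebra A] [CStarAlgebra B]
    (f : A →⋆ₐ[ℂ] B) (a : A) : ‖f a‖ ≤ ‖a‖ :=
  NonUnitalStarAlgHom.norm_apply_le f a

lemma continuous_starHom {A B : Type*} [CStarAlgebra A] [CStarAlgebra B]
    (f : A →⋆ₐ[ℂ] B) : Continuous f :=
  AddMonoidHomClass.continuous_of_bound f 1 fun x => by simpa using norm_starHom_le f x

end Representations

section Matrices

variable {D : Type*} [CStarAlgebra D] {n : Type*} [Fintype n] [DecidableEq n]
  {F : Type*} [NormedAddCommGroup F] [InnerProductSpace ℂ F] [CompleteSpace F]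

/-- The operator on `F^n` given by a matrix of operators on `F`. -/
def matOp (T : n → n → F →L[ℂ] F) :
    PiLp 2 (fun _ : n => F) →L[ℂ] PiLp 2 (fun _ : n => F) :=
  (PiLp.continuousLinearEquiv 2 ℂ (fun _ : n => F)).symm.toContinuousLinearMap ∘L
    ContinuousLinearMap.pi fun i => ∑ j, T i j ∘L PiLp.proj 2 (fun _ : n => F) j

@[simp] lemma matOp_apply (T : n → n → F →L[ℂ] F) (h : PiLp 2 (fun _ : n => F)) (i : n) :
    matOp T h i = ∑ j, T i j (h j) := by
  simp [matOp]

lemma clm_ext_piLp {S T : PiLp 2 (fun _ : n => F) →L[ℂ] PiLp 2 (fun _ : n => F)}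
    (h : ∀ x i, S x i = T x i) : S = T := by
  ext x i; exact h x i

/-- The entrywise action of matrices over `D` on `F^n`, for a representation of `D` on `F`. -/
def matHom (σ : D →⋆ₐ[ℂ] (F →L[ℂ] F)) :
    CStarMatrix n n D →⋆ₐ[ℂ] (PiLp 2 (fun _ : n => F) →L[ℂ] PiLp 2 (fun _ : n => F)) where
  toFun M := matOp fun i j => σ (M i j)
  map_one' := clm_ext_piLp fun x i => by
    rw [matOp_apply, Finset.sum_eq_single i]
    · simp
    · intro j _ hj
      rw [CStarMatrix.one_apply_ne hj.symm, map_zero, zero_apply]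
    · simp
  map_mul' M N := clm_ext_piLp fun x i => by
    simp only [matOp_apply, CStarMatrix.mul_apply, map_sum, map_mul, mul_apply_eq_comp,
      sum_apply]
    exact Finset.sum_comm
  map_zero' := clm_ext_piLp fun x i => by simp
  map_add' M N := clm_ext_piLp fun x i => by simp [Finset.sum_add_distrib]
  commutes' c := clm_ext_piLp fun x i => by
    rw [Algebra.algebraMap_eq_smul_one, Algebra.algebraMap_eq_smul_one, matOp_apply,
      Finset.sum_eq_single i]
    · simp
    · intro j _ hj
      rw [CStarMatrix.smul_apply, CStarMatrix.one_apply_ne hj.symm, smul_zero, map_zero,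
        zero_apply]
    · simp
  map_star' M := by
    rw [ContinuousLinearMap.star_eq_adjoint, ContinuousLinearMap.eq_adjoint_iff]
    intro x y
    simp only [PiLp.inner_apply, matOp_apply, sum_inner, inner_sum]
    rw [Finset.sum_comm]
    refine Finset.sum_congr rfl fun i _ => Finset.sum_congr rfl fun j _ => ?_
    rw [CStarMatrix.star_apply, map_star, ContinuousLinearMap.star_eq_adjoint,
      ContinuousLinearMap.adjoint_inner_left]

lemma matHom_apply (σ : D →⋆ₐ[ℂ] (F →L[ℂ] F)) (M : CStarMatrix n n D)
    (h : PiLp 2 (fun _ : n => F)) (i : n) : matHom σ M h i = ∑ j, σ (M i j) (h j) :=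
  matOp_apply _ _ _

/-- If a matrix is killed by the action on `F^n`, then so are all its entries on `F`. -/
lemma entry_eq_zero {σ : D →⋆ₐ[ℂ] (F →L[ℂ] F)} {M : CStarMatrix n n D} (h : matHom σ M = 0)
    (i j : n) : σ (M i j) = 0 := by
  ext x
  have h1 : matHom σ M (WithLp.toLp 2 (Pi.single j x)) i = 0 := by rw [h]; rfl
  rw [matHom_apply, Finset.sum_eq_single j] at h1
  · simpa using h1
  · intro k _ hk
    simp [Pi.single_eq_of_ne hk]
  · simp

/-- The norm in a C*-algebra is controlled by any separating family of `*`-homomorphisms. -/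
lemma norm_le_of_separating_homs {N : Type*} [CStarAlgebra N] {ι : Sort*} {M : ι → Type*}
    [∀ i, CStarAlgebra (M i)] (φ : ∀ i, N →⋆ₐ[ℂ] M i)
    (hφ : ∀ x, (∀ i, φ i x = 0) → x = 0) {x : N} {c : ℝ} (hc : 0 ≤ c)
    (h : ∀ i, ‖φ i x‖ ≤ c) : ‖x‖ ≤ c := by
  rcases subsingleton_or_nontrivial N with hN | hN
  · rw [Subsingleton.elim x 0, norm_zero]; exact hc
  have hsa : IsSelfAdjoint (star x * x) := IsSelfAdjoint.star_mul_self x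
  set a := star x * x with ha
  let f : ℝ → ℝ := fun t => max (|t| - c ^ 2) 0
  have hf : Continuous f := by fun_prop
  have h0 : cfc f a = 0 := by
    refine hφ _ fun i => ?_
    rcases subsingleton_or_nontrivial (M i) with hM | hM
    · exact Subsingleton.elim _ _
    have hsb : IsSelfAdjoint (φ i a) := hsa.map (φ i)
    rw [StarAlgHomClass.map_cfc (R := ℝ) (S := ℂ) (φ i) f a hf.continuousOn
      (continuous_starHom (φ i)) hsa hsb]
    rw [← cfc_const_zero ℝ (φ i a)]
    refine cfc_congr fun t ht => ?_
    have h1 := spectrum.norm_le_norm_of_mem ht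
    have h2 : ‖φ i a‖ ≤ c ^ 2 := by
      rw [ha, map_mul, map_star, CStarRing.norm_star_mul_self, ← sq]
      exact pow_le_pow_left₀ (norm_nonneg _) (h i) 2
    rw [Real.norm_eq_abs] at h1
    exact max_eq_right (by linarith)
  have h1 : ∀ t ∈ spectrum ℝ a, |t| ≤ c ^ 2 := by
    intro t ht
    have h2 : f t ∈ spectrum ℝ (cfc f a) := by
      rw [cfc_map_spectrum f a hsa hf.continuousOn]
      exact ⟨t, ht, rfl⟩
    rw [h0, spectrum.zero_eq, Set.mem_singleton_iff] at h2
    have h3 := le_max_left (|t| - c ^ 2) 0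
    have h4 : f t = max (|t| - c ^ 2) 0 := rfl
    linarith
  have h2 : ‖a‖ ≤ c ^ 2 := by
    rcases CStarAlgebra.norm_or_neg_norm_mem_spectrum hsa with h | h
    · simpa using h1 _ h
    · simpa using h1 _ h
  rw [ha, CStarRing.norm_star_mul_self, ← sq] at h2
  exact (sq_le_sq₀ (norm_nonneg _) hc).mp h2

end Matrices

section Slices

variable {A D : Type*} [CStarAlgebra A] [CStarAlgebra D] {n : Type*} [Fintype n] [DecidableEq n]
  {E F : Type*} [NormedAddCommGroup E] [InnerProductSpace ℂ E] [CompleteSpace E]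
  [NormedAddCommGroup F] [InnerProductSpace ℂ F] [CompleteSpace F]

/-- The matrix coefficient `a ↦ ⟪u, π a v⟫`. -/
def coeffFun (π : A →⋆ₐ[ℂ] (E →L[ℂ] E)) (u v : E) : A →ₗ[ℂ] ℂ where
  toFun a := ⟪u, π a v⟫_ℂ
  map_add' a b := by rw [map_add, add_apply, inner_add_right]
  map_smul' c a := by
    rw [map_smul, smul_apply, inner_smul_right]; rfl

/-- The matrix over `D` obtained from an element of `A ⊗ D` by applying matrix coefficients of a
representation of `A` to the first leg. -/
def slice (π : A →⋆ₐ[ℂ] (E →L[ℂ] E)) (e : n → E) (x : A ⊗[ℂ] D) : CStarMatrix n n D :=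
  CStarMatrix.ofMatrix fun i j =>
    TensorProduct.lid ℂ D (LinearMap.rTensor D (coeffFun π (e i) (e j)) x)

lemma slice_apply (π : A →⋆ₐ[ℂ] (E →L[ℂ] E)) (e : n → E) (x : A ⊗[ℂ] D) (i j : n) :
    slice π e x i j = TensorProduct.lid ℂ D (LinearMap.rTensor D (coeffFun π (e i) (e j)) x) :=
  rfl

/-- The vector `∑ i, e i ⊗ h i`. -/
def combine (e : n → E) (h : PiLp 2 (fun _ : n => F)) : E ⊗[ℂ] F := ∑ i, e i ⊗ₜ[ℂ] h i

lemma norm_combine {e : n → E} (he : Orthonormal ℂ e) (h : PiLp 2 (fun _ : n => F)) :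
    ‖combine e h‖ = ‖h‖ := by
  have h1 : ⟪combine e h, combine e h⟫_ℂ = ⟪h, h⟫_ℂ := by
    simp only [combine, sum_inner, inner_sum, TensorProduct.inner_tmul, PiLp.inner_apply]
    refine Finset.sum_congr rfl fun i _ => ?_
    rw [Finset.sum_eq_single i]
    · rw [orthonormal_iff_ite.mp he]; simp
    · intro j _ hj
      rw [orthonormal_iff_ite.mp he]; simp [hj]
    · simp
  have h2 := congrArg Complex.re h1
  have h3 : ‖combine e h‖ ^ 2 = _ := norm_sq_eq_re_inner (𝕜 := ℂ) (combine e h)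
  have h4 : ‖h‖ ^ 2 = _ := norm_sq_eq_re_inner (𝕜 := ℂ) h
  exact (sq_eq_sq₀ (norm_nonneg _) (norm_nonneg _)).mp (h3.trans (h2.trans h4.symm))

lemma inner_repTensor_combine (π : A →⋆ₐ[ℂ] (E →L[ℂ] E)) (σ : D →⋆ₐ[ℂ] (F →L[ℂ] F)) (e : n → E)
    (x : A ⊗[ℂ] D) (h h' : PiLp 2 (fun _ : n => F)) :
    ⟪HilbertTensor.of (combine e h'), repTensor π σ x (HilbertTensor.of (combine e h))⟫_ℂ =
      ⟪h', matHom σ (slice π e x) h⟫_ℂ := by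
  simp only [PiLp.inner_apply, matHom_apply, slice_apply]
  induction x with
  | zero => simp only [map_zero, zero_apply, inner_zero_right, Finset.sum_const_zero]
  | add x y hx hy =>
    simp only [map_add, add_apply, inner_add_right, hx, hy, Finset.sum_add_distrib]
  | tmul a d =>
    rw [repTensor_tmul, opTensor_of, LinearIsometry.inner_map_map]
    simp only [combine, map_sum, sum_inner, inner_sum, TensorProduct.map_tmul,
      TensorProduct.inner_tmul, LinearMap.rTensor_tmul, TensorProduct.lid_tmul, map_smul,
      smul_apply, inner_smul_right]
    rw [Finset.sum_comm]
    rfl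

lemma exists_combine (v w : E ⊗[ℂ] F) : ∃ (m : ℕ) (e : Fin m → E) (_ : Orthonormal ℂ e)
    (h h' : PiLp 2 (fun _ : Fin m => F)), combine e h = v ∧ combine e h' = w := by
  obtain ⟨E', hE', hz⟩ := TensorProduct.exists_finite_submodule_left_of_setFinite {v, w}
    (Set.toFinite _)
  haveI := hE'
  let b := stdOrthonormalBasis ℂ E'
  have key : ∀ u : E' ⊗[ℂ] F, ∃ h : PiLp 2 (fun _ : Fin (Module.finrank ℂ E') => F),
      combine (fun i => (b i : E)) h = LinearMap.rTensor F E'.subtype u := by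
    intro u
    induction u with
    | zero => exact ⟨0, by simp [combine]⟩
    | add u u' hu hu' =>
      obtain ⟨h, hh⟩ := hu
      obtain ⟨h', hh'⟩ := hu'
      refine ⟨h + h', ?_⟩
      rw [map_add, ← hh, ← hh']
      simp [combine, TensorProduct.tmul_add, Finset.sum_add_distrib]
    | tmul x y =>
      refine ⟨WithLp.toLp 2 fun i => ⟪b i, x⟫_ℂ • y, ?_⟩
      rw [LinearMap.rTensor_tmul]
      conv_rhs => rw [← b.sum_repr' x]
      simp [combine, TensorProduct.sum_tmul, TensorProduct.smul_tmul']
  obtain ⟨v', hv'⟩ := hz (Set.mem_insert v {w})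
  obtain ⟨w', hw'⟩ := hz (Set.mem_insert_of_mem v (Set.mem_singleton w))
  obtain ⟨h, hh⟩ := key v'
  obtain ⟨h', hh'⟩ := key w'
  exact ⟨_, _, b.orthonormal.comp_linearIsometry E'.subtypeₗᵢ, h, h', hh.trans hv', hh'.trans hw'⟩

/-- Bounds on the algebraic tensor product can be tested on any family of representations of
the second factor that separates its points. -/
lemma norm_repTensor_le_of_separating {ι : Sort*} {G : ι → Type*}
    [∀ i, NormedAddCommGroup (G i)] [∀ i, InnerProductSpace ℂ (G i)] [∀ i, CompleteSpace (G i)]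
    (τ : ∀ i, D →⋆ₐ[ℂ] (G i →L[ℂ] G i)) (hτ : ∀ d, (∀ i, τ i d = 0) → d = 0)
    (π : A →⋆ₐ[ℂ] (E →L[ℂ] E)) (σ : D →⋆ₐ[ℂ] (F →L[ℂ] F)) (x : A ⊗[ℂ] D) {c : ℝ} (hc : 0 ≤ c)
    (h : ∀ i, ‖repTensor π (τ i) x‖ ≤ c) : ‖repTensor π σ x‖ ≤ c := by
  refine opNorm_le_of_dense HilbertTensor.denseRange_of _ hc fun v w => ?_
  obtain ⟨m, e, he, k, k', rfl, rfl⟩ := exists_combine v w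
  letI := CStarAlgebra.spectralOrder D
  haveI := CStarAlgebra.spectralOrderedRing D
  have h1 : ‖slice π e x‖ ≤ c := by
    refine norm_le_of_separating_homs (fun i => matHom (n := Fin m) (τ i)) (fun M hM => ?_) hc
      fun i => ?_
    · refine CStarMatrix.ext fun a b => hτ _ fun i => entry_eq_zero (hM i) a b
    · refine opNorm_le_of_dense (J := id) denseRange_id _ hc fun u u' => ?_
      rw [id, id, ← inner_repTensor_combine]
      refine (norm_inner_le_norm _ _).trans ?_
      rw [LinearIsometry.norm_map, norm_combine he]
      have h2 := (repTensor π (τ i) x).le_of_opNorm_le (h i) (HilbertTensor.of (combine e u'))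
      rw [LinearIsometry.norm_map, norm_combine he] at h2
      calc ‖u‖ * _ ≤ ‖u‖ * (c * ‖u'‖) := mul_le_mul_of_nonneg_left h2 (norm_nonneg _)
        _ = _ := by ring
  rw [inner_repTensor_combine]
  refine (norm_inner_le_norm _ _).trans ?_
  rw [LinearIsometry.norm_map, LinearIsometry.norm_map, norm_combine he, norm_combine he]
  have h2 := (matHom σ (slice π e x)).le_of_opNorm_le ((norm_starHom_le (matHom σ) _).trans h1) k'
  calc ‖k‖ * _ ≤ ‖k‖ * (c * ‖k'‖) := mul_le_mul_of_nonneg_left h2 (norm_nonneg _)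
    _ = _ := by ring

end Slices

section MinTensor

/-- A (bundled) unital `*`-representation of a C*-algebra on a complex Hilbert space. -/
structure Rep (A : Type u) [CStarAlgebra A] where
  /-- the Hilbert space -/
  space : Type u
  [normedAddCommGroup : NormedAddCommGroup space]
  [innerProductSpace : InnerProductSpace ℂ space]
  [completeSpace : CompleteSpace space]
  /-- the action by bounded operators -/
  hom : A →⋆ₐ[ℂ] (space →L[ℂ] space)

attribute [instance] Rep.normedAddCommGroup Rep.innerProductSpace Rep.completeSpace

variable {A B C D A' B' : Type u} [CStarAlgebra A] [CStarAlgebra B] [CStarAlgebra C]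
  [CStarAlgebra D] [CStarAlgebra A'] [CStarAlgebra B']

/-- The minimal (spatial) C*-norm on the algebraic tensor product of two C*-algebras: the supremum
of `‖(π ⊗ ρ)(x)‖` over all pairs of representations `π` of `A` and `ρ` of `B`. -/
def minNorm (x : A ⊗[ℂ] B) : ℝ :=
  ⨆ p : Rep A × Rep B, ‖repTensor p.1.hom p.2.hom x‖

lemma bddAbove_minNorm (x : A ⊗[ℂ] B) :
    BddAbove (Set.range fun p : Rep A × Rep B => ‖repTensor p.1.hom p.2.hom x‖) := by
  suffices h : ∃ c : ℝ, ∀ p : Rep A × Rep B, ‖repTensor p.1.hom p.2.hom x‖ ≤ c by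
    obtain ⟨c, hc⟩ := h
    exact ⟨c, by rintro _ ⟨p, rfl⟩; exact hc p⟩
  induction x with
  | zero => exact ⟨0, fun p => by rw [map_zero, norm_zero]⟩
  | tmul a b =>
    refine ⟨‖a‖ * ‖b‖, fun p => ?_⟩
    rw [repTensor_tmul]
    exact (norm_opTensor_le _ _).trans (mul_le_mul (norm_starHom_le _ _) (norm_starHom_le _ _)
      (norm_nonneg _) (norm_nonneg _))
  | add x y hx hy =>
    obtain ⟨c, hc⟩ := hx
    obtain ⟨d, hd⟩ := hy
    exact ⟨c + d, fun p => by
      rw [map_add]; exact (norm_add_le _ _).trans (add_le_add (hc p) (hd p))⟩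

lemma le_minNorm (π : Rep A) (ρ : Rep B) (x : A ⊗[ℂ] B) :
    ‖repTensor π.hom ρ.hom x‖ ≤ minNorm x :=
  le_ciSup (bddAbove_minNorm x) (π, ρ)

lemma minNorm_le {x : A ⊗[ℂ] B} {c : ℝ} (hc : 0 ≤ c)
    (h : ∀ (π : Rep A) (ρ : Rep B), ‖repTensor π.hom ρ.hom x‖ ≤ c) : minNorm x ≤ c :=
  Real.iSup_le (fun p => h p.1 p.2) hc

lemma minNorm_nonneg (x : A ⊗[ℂ] B) : 0 ≤ minNorm x :=
  Real.iSup_nonneg fun _ => norm_nonneg _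

/-- The algebraic tensor product of two C*-algebras, as a `*`-algebra seminormed by the minimal
C*-norm. -/
def AlgTensor (A B : Type u) [CStarAlgebra A] [CStarAlgebra B] : Type u := A ⊗[ℂ] B

namespace AlgTensor

instance : Ring (AlgTensor A B) := inferInstanceAs (Ring (A ⊗[ℂ] B))
instance : StarRing (AlgTensor A B) := inferInstanceAs (StarRing (A ⊗[ℂ] B))
instance : Algebra ℂ (AlgTensor A B) := inferInstanceAs (Algebra ℂ (A ⊗[ℂ] B))
instance : StarModule ℂ (AlgTensor A B) := inferInstanceAs (StarModule ℂ (A ⊗[ℂ] B))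

/-- The tensor product of two representations, on `AlgTensor A B`. -/
def rep (π : Rep A) (ρ : Rep B) : AlgTensor A B →⋆ₐ[ℂ]
    (HilbertTensor π.space ρ.space →L[ℂ] HilbertTensor π.space ρ.space) :=
  repTensor π.hom ρ.hom

/-- The minimal C*-norm as a function on `AlgTensor A B`. -/
def mNorm (x : AlgTensor A B) : ℝ := minNorm (A := A) (B := B) x

lemma le_mNorm (π : Rep A) (ρ : Rep B) (x : AlgTensor A B) : ‖rep π ρ x‖ ≤ mNorm x :=
  le_minNorm π ρ x

lemma mNorm_le {x : AlgTensor A B} {c : ℝ} (hc : 0 ≤ c)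
    (h : ∀ (π : Rep A) (ρ : Rep B), ‖rep π ρ x‖ ≤ c) : mNorm x ≤ c :=
  minNorm_le hc h

lemma mNorm_nonneg (x : AlgTensor A B) : 0 ≤ mNorm x := minNorm_nonneg (A := A) (B := B) x

lemma mNorm_congr {x y : AlgTensor A B}
    (h : ∀ (π : Rep A) (ρ : Rep B), ‖rep π ρ x‖ = ‖rep π ρ y‖) : mNorm x = mNorm y :=
  congrArg iSup (funext fun p => h p.1 p.2)

/-- The minimal C*-norm as a seminorm of an additive group. -/
def addGroupSeminorm : AddGroupSeminorm (AlgTensor A B) where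
  toFun := mNorm
  map_zero' := le_antisymm (mNorm_le le_rfl fun π ρ => by rw [map_zero, norm_zero])
    (mNorm_nonneg _)
  add_le' x y := mNorm_le (add_nonneg (mNorm_nonneg _) (mNorm_nonneg _)) fun π ρ => by
    rw [map_add]
    exact (norm_add_le _ _).trans (add_le_add (le_mNorm π ρ x) (le_mNorm π ρ y))
  neg' x := mNorm_congr fun π ρ => by rw [map_neg, norm_neg]

instance : SeminormedRing (AlgTensor A B) where
  __ := addGroupSeminorm.toSeminormedAddCommGroup
  __ := (inferInstance : Ring (AlgTensor A B))
  norm_mul_le x y := mNorm_le (mul_nonneg (mNorm_nonneg _) (mNorm_nonneg _)) fun π ρ => by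
    rw [map_mul]
    exact (norm_mul_le _ _).trans (mul_le_mul (le_mNorm π ρ x) (le_mNorm π ρ y)
      (norm_nonneg _) (mNorm_nonneg _))

lemma norm_def (x : AlgTensor A B) : ‖x‖ = mNorm x := rfl

instance : NormedAlgebra ℂ (AlgTensor A B) where
  norm_smul_le c x := mNorm_le (mul_nonneg (norm_nonneg _) (mNorm_nonneg _)) fun π ρ => by
    rw [map_smul, norm_smul]
    exact mul_le_mul_of_nonneg_left (le_mNorm π ρ x) (norm_nonneg _)

lemma norm_star' (x : AlgTensor A B) : ‖star x‖ = ‖x‖ :=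
  mNorm_congr fun π ρ => by rw [map_star, norm_star]

lemma norm_mul_self_le' (x : AlgTensor A B) : ‖x‖ * ‖x‖ ≤ ‖star x * x‖ := by
  have h : ‖x‖ ≤ √‖star x * x‖ := mNorm_le (Real.sqrt_nonneg _) fun π ρ => by
    refine Real.le_sqrt_of_sq_le ?_
    rw [sq, ← CStarRing.norm_star_mul_self, ← map_star, ← map_mul]
    exact le_mNorm π ρ _
  calc ‖x‖ * ‖x‖ ≤ √‖star x * x‖ * √‖star x * x‖ :=
        mul_le_mul h h (norm_nonneg _) (Real.sqrt_nonneg _)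
    _ = _ := Real.mul_self_sqrt (norm_nonneg _)

lemma uniformContinuous_star : UniformContinuous (star : AlgTensor A B → AlgTensor A B) := by
  refine Isometry.uniformContinuous (Isometry.of_dist_eq fun x y => ?_)
  rw [dist_eq_norm, dist_eq_norm, ← star_sub, norm_star']

end AlgTensor

/-- The minimal tensor product of two C*-algebras: the completion of the algebraic tensor product
in the minimal C*-norm. -/
def MinTensor (A B : Type u) [CStarAlgebra A] [CStarAlgebra B] : Type u :=
  UniformSpace.Completion (AlgTensor A B)

/-- The minimal tensor product of C*-algebras. -/
infixr:100 " ⊗ₘ " => MinTensor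

namespace MinTensor

open UniformSpace (Completion)

instance : NormedRing (A ⊗ₘ B) := inferInstanceAs (NormedRing (Completion (AlgTensor A B)))
instance : CompleteSpace (A ⊗ₘ B) := inferInstanceAs (CompleteSpace (Completion (AlgTensor A B)))

instance : Algebra ℂ (A ⊗ₘ B) := inferInstanceAs (Algebra ℂ (Completion (AlgTensor A B)))

/-- The canonical map from the algebraic tensor product, as a mere function. -/
def ofFun (x : AlgTensor A B) : A ⊗ₘ B := (x : Completion (AlgTensor A B))

lemma denseRange_ofFun : DenseRange (ofFun : AlgTensor A B → A ⊗ₘ B) :=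
  Completion.denseRange_coe

lemma norm_ofFun (x : AlgTensor A B) : ‖ofFun x‖ = ‖x‖ := Completion.norm_coe x

lemma ofFun_mul (x y : AlgTensor A B) : ofFun (x * y) = ofFun x * ofFun y :=
  Completion.coe_mul x y

lemma ofFun_add (x y : AlgTensor A B) : ofFun (x + y) = ofFun x + ofFun y :=
  Completion.coe_add x y

lemma ofFun_smul (c : ℂ) (x : AlgTensor A B) : ofFun (c • x) = c • ofFun x :=
  Completion.coe_smul c x

instance : NormedAlgebra ℂ (A ⊗ₘ B) where
  norm_smul_le c x := by
    refine denseRange_ofFun.induction_on (p := fun x => ‖c • x‖ ≤ ‖c‖ * ‖x‖) x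
      (isClosed_le (by simp_rw [Algebra.smul_def]; fun_prop) (by fun_prop)) fun x => ?_
    rw [← ofFun_smul, norm_ofFun, norm_ofFun]
    exact norm_smul_le c x

/-- The involution, extended by continuity. -/
def starFun : A ⊗ₘ B → A ⊗ₘ B :=
  Completion.map (star : AlgTensor A B → AlgTensor A B)

lemma continuous_starFun : Continuous (starFun : A ⊗ₘ B → A ⊗ₘ B) := Completion.continuous_map

lemma starFun_ofFun (x : AlgTensor A B) : starFun (ofFun x) = ofFun (star x) :=
  Completion.map_coe AlgTensor.uniformContinuous_star x

instance : StarRing (A ⊗ₘ B) where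
  star := starFun
  star_involutive x := by
    refine denseRange_ofFun.induction_on (p := fun x => starFun (starFun x) = x) x
      (isClosed_eq (continuous_starFun.comp continuous_starFun) continuous_id) fun x => ?_
    rw [starFun_ofFun, starFun_ofFun, star_star]
  star_mul x y := by
    have h1 := continuous_starFun (A := A) (B := B)
    refine denseRange_ofFun.induction_on₂
      (p := fun x y : A ⊗ₘ B => starFun (x * y) = starFun y * starFun x)
      (isClosed_eq (by fun_prop) (by fun_prop)) (fun x y => ?_) x y
    rw [← ofFun_mul, starFun_ofFun, starFun_ofFun, starFun_ofFun, star_mul, ofFun_mul]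
  star_add x y := by
    have h1 := continuous_starFun (A := A) (B := B)
    refine denseRange_ofFun.induction_on₂
      (p := fun x y : A ⊗ₘ B => starFun (x + y) = starFun x + starFun y)
      (isClosed_eq (by fun_prop) (by fun_prop)) (fun x y => ?_) x y
    rw [← ofFun_add, starFun_ofFun, starFun_ofFun, starFun_ofFun, star_add, ofFun_add]

lemma star_ofFun (x : AlgTensor A B) : star (ofFun x) = ofFun (star x) := starFun_ofFun x

lemma continuous_star' : Continuous (star : A ⊗ₘ B → A ⊗ₘ B) := continuous_starFun

instance : StarModule ℂ (A ⊗ₘ B) where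
  star_smul c x := by
    have h1 := continuous_star' (A := A) (B := B)
    refine denseRange_ofFun.induction_on
      (p := fun x : A ⊗ₘ B => star (c • x) = star c • star x) x
      (isClosed_eq (h1.comp (continuous_const_smul c)) (h1.const_smul (star c))) fun x => ?_
    rw [star_ofFun, ← ofFun_smul, ← ofFun_smul, star_ofFun, star_smul]

instance : CStarAlgebra (A ⊗ₘ B) where
  __ := (inferInstance : NormedRing (A ⊗ₘ B))
  __ := (inferInstance : StarRing (A ⊗ₘ B))
  __ := (inferInstance : NormedAlgebra ℂ (A ⊗ₘ B))
  __ := (inferInstance : CompleteSpace (A ⊗ₘ B))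
  norm_mul_self_le x := by
    have h1 := continuous_star' (A := A) (B := B)
    refine denseRange_ofFun.induction_on
      (p := fun x : A ⊗ₘ B => ‖x‖ * ‖x‖ ≤ ‖star x * x‖) x
      (isClosed_le (by fun_prop) (by fun_prop)) fun x => ?_
    rw [star_ofFun, ← ofFun_mul, norm_ofFun, norm_ofFun]
    exact AlgTensor.norm_mul_self_le' x
  star_smul := star_smul

/-- The canonical map from the algebraic to the minimal tensor product. -/
def of : A ⊗[ℂ] B →⋆ₐ[ℂ] A ⊗ₘ B where
  toFun x := ofFun (show AlgTensor A B from x)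
  map_one' := Completion.coe_one (α := AlgTensor A B)
  map_mul' x y := ofFun_mul (A := A) (B := B) x y
  map_zero' := Completion.coe_zero (α := AlgTensor A B)
  map_add' x y := ofFun_add (A := A) (B := B) x y
  commutes' _ := rfl
  map_star' x := (star_ofFun (A := A) (B := B) x).symm

lemma denseRange_of : DenseRange (of : A ⊗[ℂ] B → A ⊗ₘ B) :=
  denseRange_ofFun (A := A) (B := B)

lemma norm_of (x : A ⊗[ℂ] B) : ‖of x‖ = minNorm x :=
  norm_ofFun (A := A) (B := B) x

/-- The elementary tensor `a ⊗ b`. -/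
def tmul (a : A) (b : B) : A ⊗ₘ B := of (a ⊗ₜ b)

/-- To prove a closed additive property it suffices to look at elementary tensors. -/
lemma induction_on {p : A ⊗ₘ B → Prop} (hp : IsClosed {x | p x}) (h0 : p 0)
    (htmul : ∀ a b, p (tmul a b)) (hadd : ∀ x y, p x → p y → p (x + y)) (x : A ⊗ₘ B) : p x := by
  refine denseRange_of.induction_on x hp fun x => ?_
  induction x with
  | zero => rwa [map_zero]
  | tmul a b => exact htmul a b
  | add x y hx hy => rw [map_add]; exact hadd _ _ hx hy

/-- Unital `*`-homomorphisms on a minimal tensor product that agree on elementary tensors are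
equal. -/
lemma hom_ext {f g : A ⊗ₘ B →⋆ₐ[ℂ] D} (h : ∀ a b, f (tmul a b) = g (tmul a b)) : f = g := by
  refine StarAlgHom.ext fun x => ?_
  refine induction_on (p := fun x => f x = g x)
    (isClosed_eq (continuous_starHom f) (continuous_starHom g)) ?_ h ?_ x
  · rw [map_zero, map_zero]
  · intro x y hx hy
    rw [map_add, map_add, hx, hy]

section lift

variable {E : Type*} [CStarAlgebra E] (θ : A ⊗[ℂ] B →⋆ₐ[ℂ] E)

/-- The extension by continuity of a `*`-homomorphism on the algebraic tensor product, as a mere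
function. -/
def liftFun : A ⊗ₘ B → E := Completion.extension (α := AlgTensor A B) θ

lemma uniformContinuous_lift (hθ : ∀ x, ‖θ x‖ ≤ minNorm x) : UniformContinuous (fun x : AlgTensor A B => θ x) := by
  refine LipschitzWith.uniformContinuous (K := 1) (LipschitzWith.of_dist_le_mul fun x y => ?_)
  rw [dist_eq_norm, dist_eq_norm, NNReal.coe_one, one_mul]
  rw [show θ x - θ y = θ (x - y : AlgTensor A B) from (map_sub θ _ _).symm]
  exact hθ _

lemma continuous_liftFun : Continuous (liftFun θ) := Completion.continuous_extension

lemma liftFun_of (hθ : ∀ x, ‖θ x‖ ≤ minNorm x) (x : A ⊗[ℂ] B) : liftFun θ (of x) = θ x :=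
  Completion.extension_coe (uniformContinuous_lift θ hθ) x

/-- The extension by continuity of a `*`-homomorphism that is contractive for the minimal norm. -/
def lift (hθ : ∀ x, ‖θ x‖ ≤ minNorm x) : A ⊗ₘ B →⋆ₐ[ℂ] E where
  toFun := liftFun θ
  map_one' := by rw [← map_one of, liftFun_of θ hθ, map_one]
  map_mul' x y := by
    have h1 := continuous_liftFun θ
    refine denseRange_of.induction_on₂
      (p := fun x y => liftFun θ (x * y) = liftFun θ x * liftFun θ y)
      (isClosed_eq (by fun_prop) (by fun_prop)) (fun x y => ?_) x y
    rw [← map_mul, liftFun_of θ hθ, liftFun_of θ hθ, liftFun_of θ hθ, map_mul]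
  map_zero' := by rw [← map_zero of, liftFun_of θ hθ, map_zero]
  map_add' x y := by
    have h1 := continuous_liftFun θ
    refine denseRange_of.induction_on₂
      (p := fun x y => liftFun θ (x + y) = liftFun θ x + liftFun θ y)
      (isClosed_eq (by fun_prop) (by fun_prop)) (fun x y => ?_) x y
    rw [← map_add, liftFun_of θ hθ, liftFun_of θ hθ, liftFun_of θ hθ, map_add]
  commutes' c := by
    rw [← AlgHomClass.commutes (of : A ⊗[ℂ] B →⋆ₐ[ℂ] A ⊗ₘ B) c, liftFun_of θ hθ,
      AlgHomClass.commutes θ c]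
  map_star' x := by
    have h1 := continuous_liftFun θ
    refine denseRange_of.induction_on (p := fun x => liftFun θ (star x) = star (liftFun θ x)) x
      (isClosed_eq (by fun_prop) (by fun_prop)) fun x => ?_
    rw [← map_star, liftFun_of θ hθ, liftFun_of θ hθ, map_star]

lemma lift_of (hθ : ∀ x, ‖θ x‖ ≤ minNorm x) (x : A ⊗[ℂ] B) : lift θ hθ (of x) = θ x := liftFun_of θ hθ x

lemma lift_tmul (hθ : ∀ x, ‖θ x‖ ≤ minNorm x) (a : A) (b : B) : lift θ hθ (tmul a b) = θ (a ⊗ₜ b) := liftFun_of θ hθ _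

end lift

section prodHom

variable {E F : Type u} [NormedAddCommGroup E] [InnerProductSpace ℂ E] [CompleteSpace E]
  [NormedAddCommGroup F] [InnerProductSpace ℂ F] [CompleteSpace F]

/-- The tensor product of two representations, as a representation of the minimal tensor product
on the Hilbert space tensor product. -/
def prodHom (π : A →⋆ₐ[ℂ] (E →L[ℂ] E)) (ρ : B →⋆ₐ[ℂ] (F →L[ℂ] F)) :
    A ⊗ₘ B →⋆ₐ[ℂ] (HilbertTensor E F →L[ℂ] HilbertTensor E F) :=
  lift (repTensor π ρ) fun x => le_minNorm ⟨E, π⟩ ⟨F, ρ⟩ x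

lemma prodHom_of (π : A →⋆ₐ[ℂ] (E →L[ℂ] E)) (ρ : B →⋆ₐ[ℂ] (F →L[ℂ] F)) (x : A ⊗[ℂ] B) :
    prodHom π ρ (of x) = repTensor π ρ x := lift_of _ _ _

lemma prodHom_tmul (π : A →⋆ₐ[ℂ] (E →L[ℂ] E)) (ρ : B →⋆ₐ[ℂ] (F →L[ℂ] F)) (a : A) (b : B) :
    prodHom π ρ (tmul a b) = opTensor (π a) (ρ b) := by
  rw [tmul, prodHom_of, repTensor_tmul]

end prodHom

/-- A bound that holds on the algebraic tensor product up to any error holds everywhere. -/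
lemma norm_le_of_approx {x : A ⊗ₘ B} {c : ℝ}
    (h : ∀ ε > 0, ∀ y : A ⊗[ℂ] B, ‖x - of y‖ < ε → ‖of y‖ ≤ c + ε) : ‖x‖ ≤ c := by
  refine le_of_forall_pos_le_add fun ε hε => ?_
  obtain ⟨y, hy⟩ := denseRange_of.exists_dist_lt x (half_pos hε)
  rw [dist_eq_norm] at hy
  have h1 := h _ (half_pos hε) y hy
  have h2 : ‖x‖ ≤ ‖x - of y‖ + ‖of y‖ := by
    simpa using norm_add_le (x - of y) (of y)
  linarith

lemma tmul_mul (a a' : A) (b b' : B) : tmul a b * tmul a' b' = tmul (a * a') (b * b') := by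
  rw [tmul, tmul, ← map_mul, Algebra.TensorProduct.tmul_mul_tmul, tmul]

/-- The inclusion `a ↦ a ⊗ 1`. -/
def inl : A →⋆ₐ[ℂ] A ⊗ₘ B where
  toAlgHom := (of : A ⊗[ℂ] B →⋆ₐ[ℂ] A ⊗ₘ B).toAlgHom.comp Algebra.TensorProduct.includeLeft
  map_star' a := by
    change tmul (star a) (1 : B) = star (tmul a (1 : B))
    rw [tmul, tmul, ← map_star of, TensorProduct.star_tmul, star_one]

/-- The inclusion `b ↦ 1 ⊗ b`. -/
def inr : B →⋆ₐ[ℂ] A ⊗ₘ B where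
  toAlgHom := (of : A ⊗[ℂ] B →⋆ₐ[ℂ] A ⊗ₘ B).toAlgHom.comp Algebra.TensorProduct.includeRight
  map_star' a := by
    change tmul (1 : A) (star a) = star (tmul (1 : A) a)
    rw [tmul, tmul, ← map_star of, TensorProduct.star_tmul, star_one]

lemma inl_apply (a : A) : (inl a : A ⊗ₘ B) = tmul a 1 := rfl

lemma inr_apply (b : B) : (inr b : A ⊗ₘ B) = tmul 1 b := rfl

lemma inl_mul_inr (a : A) (b : B) : (inl a * inr b : A ⊗ₘ B) = tmul a b := by
  rw [inl_apply, inr_apply, tmul_mul, mul_one, one_mul]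

lemma commute_inl_inr (a : A) (b : B) : Commute (inl a : A ⊗ₘ B) (inr b) := by
  rw [Commute, SemiconjBy, inl_mul_inr, inl_apply, inr_apply, tmul_mul, mul_one, one_mul]

/-- The algebraic tensor product of two `*`-homomorphisms, with values in the minimal tensor
product. -/
def algMap (f : A →⋆ₐ[ℂ] A') (g : B →⋆ₐ[ℂ] B') : A ⊗[ℂ] B →⋆ₐ[ℂ] A' ⊗ₘ B' :=
  algLift (inl.comp f) (inr.comp g) fun a b => commute_inl_inr (f a) (g b)

lemma algMap_tmul (f : A →⋆ₐ[ℂ] A') (g : B →⋆ₐ[ℂ] B') (a : A) (b : B) :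
    algMap f g (a ⊗ₜ b) = tmul (f a) (g b) := inl_mul_inr _ _

lemma prodHom_algMap {E F : Type u} [NormedAddCommGroup E] [InnerProductSpace ℂ E]
    [CompleteSpace E] [NormedAddCommGroup F] [InnerProductSpace ℂ F] [CompleteSpace F]
    (f : A →⋆ₐ[ℂ] A') (g : B →⋆ₐ[ℂ] B') (π : A' →⋆ₐ[ℂ] (E →L[ℂ] E))
    (ρ : B' →⋆ₐ[ℂ] (F →L[ℂ] F)) (x : A ⊗[ℂ] B) :
    prodHom π ρ (algMap f g x) = repTensor (π.comp f) (ρ.comp g) x := by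
  induction x with
  | zero => simp only [map_zero]
  | add x y hx hy => simp only [map_add, hx, hy]
  | tmul a b => rw [algMap_tmul, prodHom_tmul, repTensor_tmul]; rfl

/-- The norm of the minimal tensor product is the supremum over tensor products of
representations. -/
lemma norm_le_of_prodHom {x : A ⊗ₘ B} {c : ℝ} (hc : 0 ≤ c)
    (h : ∀ (π : Rep A) (ρ : Rep B), ‖prodHom π.hom ρ.hom x‖ ≤ c) : ‖x‖ ≤ c := by
  refine norm_le_of_approx fun ε hε y hy => ?_
  rw [norm_of]
  refine minNorm_le (by positivity) fun π ρ => ?_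
  rw [← prodHom_of]
  have h1 : ‖prodHom π.hom ρ.hom (of y)‖ ≤ ‖prodHom π.hom ρ.hom (x - of y)‖ +
      ‖prodHom π.hom ρ.hom x‖ := by
    rw [map_sub, ← norm_neg (prodHom π.hom ρ.hom x - _), neg_sub]
    simpa using norm_add_le (prodHom π.hom ρ.hom (of y) - prodHom π.hom ρ.hom x)
      (prodHom π.hom ρ.hom x)
  linarith [h π ρ, (norm_starHom_le (prodHom π.hom ρ.hom) (x - of y)).trans hy.le]

/-- The tensor product `f ⊗ g` of two unital `*`-homomorphisms. -/
def map (f : A →⋆ₐ[ℂ] A') (g : B →⋆ₐ[ℂ] B') : A ⊗ₘ B →⋆ₐ[ℂ] A' ⊗ₘ B' :=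
  lift (algMap f g) fun x => norm_le_of_prodHom (minNorm_nonneg x) fun π ρ => by
    rw [prodHom_algMap]
    exact le_minNorm ⟨_, π.hom.comp f⟩ ⟨_, ρ.hom.comp g⟩ x

@[simp] lemma map_tmul (f : A →⋆ₐ[ℂ] A') (g : B →⋆ₐ[ℂ] B') (a : A) (b : B) :
    map f g (tmul a b) = tmul (f a) (g b) := by
  rw [map, lift_tmul, algMap_tmul]


section flip

variable {E F : Type u} [NormedAddCommGroup E] [InnerProductSpace ℂ E] [CompleteSpace E]
  [NormedAddCommGroup F] [InnerProductSpace ℂ F] [CompleteSpace F]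

/-- The algebraic flip, with values in the minimal tensor product. -/
def algFlip : A ⊗[ℂ] B →⋆ₐ[ℂ] B ⊗ₘ A :=
  algLift inr inl fun a b => (commute_inl_inr b a).symm

lemma algFlip_tmul (a : A) (b : B) : algFlip (a ⊗ₜ b) = tmul b a :=
  (commute_inl_inr b a).symm.eq.trans (inl_mul_inr b a)

lemma inner_prodHom_algFlip (π : A →⋆ₐ[ℂ] (E →L[ℂ] E)) (ρ : B →⋆ₐ[ℂ] (F →L[ℂ] F))
    (x : A ⊗[ℂ] B) (v w : F ⊗[ℂ] E) :
    ⟪HilbertTensor.of v, prodHom ρ π (algFlip x) (HilbertTensor.of w)⟫_ℂ =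
      ⟪HilbertTensor.of (TensorProduct.comm ℂ F E v),
        repTensor π ρ x (HilbertTensor.of (TensorProduct.comm ℂ F E w))⟫_ℂ := by
  induction x with
  | zero => simp only [map_zero, zero_apply, inner_zero_right]
  | add x y hx hy => simp only [map_add, add_apply, inner_add_right, hx, hy]
  | tmul a b =>
    rw [algFlip_tmul, prodHom_tmul, repTensor_tmul, opTensor_of, opTensor_of,
      LinearIsometry.inner_map_map, LinearIsometry.inner_map_map, ← TensorProduct.inner_comm_comm,
      TensorProduct.map_comm]

/-- The flip `A ⊗ B → B ⊗ A`. -/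
def flip : A ⊗ₘ B →⋆ₐ[ℂ] B ⊗ₘ A :=
  lift algFlip fun x => norm_le_of_prodHom (minNorm_nonneg x) fun ρ π => by
    refine (opNorm_le_of_dense HilbertTensor.denseRange_of _ (norm_nonneg _)
      fun v w => ?_).trans (le_minNorm π ρ x)
    rw [inner_prodHom_algFlip]
    refine (norm_inner_le_norm _ _).trans ?_
    have h := ContinuousLinearMap.le_opNorm (repTensor π.hom ρ.hom x)
      (HilbertTensor.of (TensorProduct.comm ℂ ρ.space π.space w))
    have h2 := mul_le_mul_of_nonneg_left h
      (norm_nonneg (HilbertTensor.of (TensorProduct.comm ℂ ρ.space π.space v)))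
    refine h2.trans (le_of_eq ?_)
    simp only [LinearIsometry.norm_map, TensorProduct.norm_comm]
    ring

@[simp] lemma flip_tmul (a : A) (b : B) : flip (tmul a b) = tmul b a := by
  rw [flip, lift_tmul, algFlip_tmul]

end flip

section assoc

/-- The norm of `A ⊗ D` can be tested on any family of representations of `D` that separates the
points of `D`. -/
lemma norm_le_of_separating {ι : Sort*} {G : ι → Type u}
    [∀ i, NormedAddCommGroup (G i)] [∀ i, InnerProductSpace ℂ (G i)] [∀ i, CompleteSpace (G i)]
    (τ : ∀ i, D →⋆ₐ[ℂ] (G i →L[ℂ] G i)) (hτ : ∀ d, (∀ i, τ i d = 0) → d = 0)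
    {x : A ⊗ₘ D} {c : ℝ} (hc : 0 ≤ c)
    (h : ∀ (π : Rep A) (i : ι), ‖prodHom π.hom (τ i) x‖ ≤ c) : ‖x‖ ≤ c := by
  refine norm_le_of_approx fun ε hε y hy => ?_
  rw [norm_of]
  refine minNorm_le (by positivity) fun π σ => ?_
  refine norm_repTensor_le_of_separating τ hτ π.hom σ.hom y (by positivity) fun i => ?_
  rw [← prodHom_of]
  have h1 : ‖prodHom π.hom (τ i) (of y)‖ ≤ ‖prodHom π.hom (τ i) (x - of y)‖ +
      ‖prodHom π.hom (τ i) x‖ := by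
    rw [map_sub, ← norm_neg (prodHom π.hom (τ i) x - _), neg_sub]
    simpa using norm_add_le (prodHom π.hom (τ i) (of y) - prodHom π.hom (τ i) x)
      (prodHom π.hom (τ i) x)
  linarith [h π i, (norm_starHom_le (prodHom π.hom (τ i)) (x - of y)).trans hy.le]

/-- The re-bracketing map on `(A ⊗ B) ⊗ C`, the outer tensor product being algebraic. -/
def algAssoc : (A ⊗ₘ B) ⊗[ℂ] C →⋆ₐ[ℂ] A ⊗ₘ (B ⊗ₘ C) :=
  algLift (map (StarAlgHom.id ℂ A) inl) (inr.comp inr) fun d c => by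
    refine induction_on (p := fun d => Commute (map (StarAlgHom.id ℂ A) inl d)
      ((inr.comp inr : C →⋆ₐ[ℂ] A ⊗ₘ (B ⊗ₘ C)) c)) ?_ ?_ (fun a b => ?_) (fun x y hx hy => ?_) d
    · have h1 := continuous_starHom (map (StarAlgHom.id ℂ A) (inl : B →⋆ₐ[ℂ] B ⊗ₘ C))
      exact isClosed_eq (by fun_prop) (by fun_prop)
    · rw [map_zero]; exact Commute.zero_left _
    · rw [map_tmul]
      change tmul a (tmul b 1) * tmul 1 (tmul 1 c) = tmul 1 (tmul 1 c) * tmul a (tmul b 1)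
      simp only [tmul_mul, mul_one, one_mul]
    · rw [map_add]; exact hx.add_left hy

lemma algAssoc_tmul (d : A ⊗ₘ B) (c : C) :
    algAssoc (d ⊗ₜ c) = map (StarAlgHom.id ℂ A) inl d * inr (inr c) := rfl

section

variable {E F G : Type u} [NormedAddCommGroup E] [InnerProductSpace ℂ E] [CompleteSpace E]
  [NormedAddCommGroup F] [InnerProductSpace ℂ F] [CompleteSpace F]
  [NormedAddCommGroup G] [InnerProductSpace ℂ G] [CompleteSpace G]

/-- The inclusion of the algebraic triple tensor product in `(E ⊗ F) ⊗ G`. -/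
def tripleL : (E ⊗[ℂ] F) ⊗[ℂ] G →ₗᵢ[ℂ] HilbertTensor (HilbertTensor E F) G :=
  HilbertTensor.of.comp (TensorProduct.mapIsometry HilbertTensor.of LinearIsometry.id)

/-- The inclusion of the algebraic triple tensor product in `E ⊗ (F ⊗ G)`. -/
def tripleR : (E ⊗[ℂ] F) ⊗[ℂ] G →ₗᵢ[ℂ] HilbertTensor E (HilbertTensor F G) :=
  (HilbertTensor.of.comp (TensorProduct.mapIsometry LinearIsometry.id HilbertTensor.of)).comp
    (TensorProduct.assocIsometry ℂ E F G).toLinearIsometry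

lemma tripleL_tmul (e : E) (f : F) (g : G) :
    tripleL ((e ⊗ₜ[ℂ] f) ⊗ₜ[ℂ] g) = HilbertTensor.of (HilbertTensor.of (e ⊗ₜ[ℂ] f) ⊗ₜ[ℂ] g) := by
  simp [tripleL]

lemma tripleR_tmul (e : E) (f : F) (g : G) :
    tripleR ((e ⊗ₜ[ℂ] f) ⊗ₜ[ℂ] g) = HilbertTensor.of (e ⊗ₜ[ℂ] HilbertTensor.of (f ⊗ₜ[ℂ] g)) := by
  simp [tripleR]

lemma denseRange_tripleR :
    DenseRange (tripleR : (E ⊗[ℂ] F) ⊗[ℂ] G → HilbertTensor E (HilbertTensor F G)) := by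
  let R := (LinearMap.range (tripleR (E := E) (F := F) (G := G)).toLinearMap).topologicalClosure
  have h1 : ∀ (e : E) (x : F ⊗[ℂ] G), HilbertTensor.of (e ⊗ₜ[ℂ] HilbertTensor.of x) ∈ R := by
    intro e x
    induction x with
    | zero => simp
    | add x y hx hy => rw [map_add, TensorProduct.tmul_add, map_add]; exact R.add_mem hx hy
    | tmul f g =>
      rw [← tripleR_tmul]
      exact Submodule.le_topologicalClosure _ ⟨_, rfl⟩
  have h2 : ∀ (e : E) (k : HilbertTensor F G), HilbertTensor.of (e ⊗ₜ[ℂ] k) ∈ R := by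
    intro e k
    refine HilbertTensor.denseRange_of.induction_on
      (p := fun k => HilbertTensor.of (e ⊗ₜ[ℂ] k) ∈ R) k ?_ (h1 e)
    refine IsClosed.preimage (f := fun k : HilbertTensor F G => HilbertTensor.of (e ⊗ₜ[ℂ] k)) ?_
      (Submodule.isClosed_topologicalClosure _)
    exact HilbertTensor.of.continuous.comp
      (TensorProduct.continuous_tmul.comp (continuous_const.prodMk continuous_id))
  have h3 : ∀ x : E ⊗[ℂ] HilbertTensor F G, HilbertTensor.of x ∈ R := by
    intro x
    induction x with
    | zero => simp
    | add x y hx hy => rw [map_add]; exact R.add_mem hx hy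
    | tmul e k => exact h2 e k
  intro z
  exact HilbertTensor.denseRange_of.induction_on (p := fun z => z ∈ R) z
    (Submodule.isClosed_topologicalClosure _) h3

lemma tripleL_zero : tripleL (0 : (E ⊗[ℂ] F) ⊗[ℂ] G) = 0 := LinearIsometry.map_zero _

lemma opTensor_tripleL (S : E →L[ℂ] E) (T : F →L[ℂ] F) (U : G →L[ℂ] G) (w : (E ⊗[ℂ] F) ⊗[ℂ] G) :
    opTensor (opTensor S T) U (tripleL w) = tripleL (TensorProduct.map
      (TensorProduct.map S.toLinearMap T.toLinearMap) U.toLinearMap w) := by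
  induction w with
  | zero => rw [LinearMap.map_zero, tripleL_zero, ContinuousLinearMap.map_zero]
  | add x y hx hy => simp only [map_add, hx, hy]
  | tmul x g =>
    induction x with
    | zero =>
      rw [TensorProduct.zero_tmul, LinearMap.map_zero, tripleL_zero,
        ContinuousLinearMap.map_zero]
    | add x y hx hy => simp only [TensorProduct.add_tmul, map_add, hx, hy]
    | tmul e f => simp [tripleL_tmul]

lemma tripleR_zero : tripleR (0 : (E ⊗[ℂ] F) ⊗[ℂ] G) = 0 := LinearIsometry.map_zero _

lemma opTensor_tripleR (S : E →L[ℂ] E) (T : F →L[ℂ] F) (U : G →L[ℂ] G) (w : (E ⊗[ℂ] F) ⊗[ℂ] G) :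
    opTensor S (opTensor T U) (tripleR w) = tripleR (TensorProduct.map
      (TensorProduct.map S.toLinearMap T.toLinearMap) U.toLinearMap w) := by
  induction w with
  | zero => rw [LinearMap.map_zero, tripleR_zero, ContinuousLinearMap.map_zero]
  | add x y hx hy => simp only [map_add, hx, hy]
  | tmul x g =>
    induction x with
    | zero =>
      rw [TensorProduct.zero_tmul, LinearMap.map_zero, tripleR_zero,
        ContinuousLinearMap.map_zero]
    | add x y hx hy => simp only [TensorProduct.add_tmul, map_add, hx, hy]
    | tmul e f => simp [tripleR_tmul]

lemma inner_tripleL (v w : (E ⊗[ℂ] F) ⊗[ℂ] G) : ⟪tripleL v, tripleL w⟫_ℂ = ⟪v, w⟫_ℂ := by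
  change ⟪HilbertTensor.of (TensorProduct.map _ _ v), HilbertTensor.of (TensorProduct.map _ _ w)⟫_ℂ
    = _
  rw [LinearIsometry.inner_map_map]
  exact TensorProduct.inner_map_map _ _ v w

lemma inner_tripleR (v w : (E ⊗[ℂ] F) ⊗[ℂ] G) : ⟪tripleR v, tripleR w⟫_ℂ = ⟪v, w⟫_ℂ := by
  change ⟪HilbertTensor.of (TensorProduct.map _ _ (TensorProduct.assoc ℂ E F G v)),
    HilbertTensor.of (TensorProduct.map _ _ (TensorProduct.assoc ℂ E F G w))⟫_ℂ = _
  rw [LinearIsometry.inner_map_map]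
  exact (TensorProduct.inner_map_map _ _ _ _).trans (TensorProduct.inner_assoc_assoc v w)

lemma inner_prodHom_algAssoc (π : A →⋆ₐ[ℂ] (E →L[ℂ] E)) (ρ : B →⋆ₐ[ℂ] (F →L[ℂ] F))
    (κ : C →⋆ₐ[ℂ] (G →L[ℂ] G)) (y : (A ⊗ₘ B) ⊗[ℂ] C) (v w : (E ⊗[ℂ] F) ⊗[ℂ] G) :
    ⟪tripleR v, prodHom π (prodHom ρ κ) (algAssoc y) (tripleR w)⟫_ℂ =
      ⟪tripleL v, repTensor (prodHom π ρ) κ y (tripleL w)⟫_ℂ := by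
  induction y with
  | zero => simp only [map_zero, zero_apply, inner_zero_right]
  | add x y hx hy => simp only [map_add, add_apply, inner_add_right, hx, hy]
  | tmul d c =>
    have h1 := continuous_starHom (map (StarAlgHom.id ℂ A) (inl : B →⋆ₐ[ℂ] B ⊗ₘ C))
    have h2 := continuous_starHom (prodHom π (prodHom ρ κ))
    have h3 := continuous_starHom (leftRep G (prodHom π ρ))
    refine induction_on (p := fun d =>
      ⟪tripleR v, prodHom π (prodHom ρ κ) (algAssoc (d ⊗ₜ c)) (tripleR w)⟫_ℂ =
      ⟪tripleL v, repTensor (prodHom π ρ) κ (d ⊗ₜ c) (tripleL w)⟫_ℂ) ?_ ?_ ?_ ?_ d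
    · refine isClosed_eq ?_ ?_
      · simp only [algAssoc_tmul]
        fun_prop
      · have h4 : ∀ d, repTensor (prodHom π ρ) κ (d ⊗ₜ c) =
          leftRep G (prodHom π ρ) d * rightRep _ κ c := fun _ => rfl
        simp only [h4]
        fun_prop
    · simp only [TensorProduct.zero_tmul, map_zero, zero_apply, inner_zero_right]
    · intro a b
      have h5 : algAssoc (tmul a b ⊗ₜ[ℂ] c) = tmul a (tmul b c) := by
        rw [algAssoc_tmul, map_tmul, inr_apply, inr_apply, inl_apply, tmul_mul, tmul_mul, mul_one,
          mul_one, one_mul]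
        rfl
      rw [h5, prodHom_tmul, prodHom_tmul, repTensor_tmul, prodHom_tmul, opTensor_tripleL,
        opTensor_tripleR]
      rw [inner_tripleR, inner_tripleL]
    · intro x y hx hy
      simp only [TensorProduct.add_tmul, map_add, add_apply, inner_add_right, hx, hy]

end

lemma eq_zero_of_prodHom {x : B ⊗ₘ C}
    (h : ∀ p : Rep B × Rep C, prodHom p.1.hom p.2.hom x = 0) : x = 0 := by
  refine norm_le_zero_iff.mp (norm_le_of_prodHom le_rfl fun π ρ => ?_)
  rw [h (π, ρ), norm_zero]

/-- The associativity isomorphism `(A ⊗ B) ⊗ C → A ⊗ (B ⊗ C)`. -/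
def assoc : (A ⊗ₘ B) ⊗ₘ C →⋆ₐ[ℂ] A ⊗ₘ (B ⊗ₘ C) :=
  lift algAssoc fun y => norm_le_of_separating
    (fun p : Rep B × Rep C => prodHom p.1.hom p.2.hom) (fun _ hd => eq_zero_of_prodHom hd)
    (minNorm_nonneg y) fun π p => by
      refine (opNorm_le_of_dense denseRange_tripleR _ (norm_nonneg _) fun v w => ?_).trans
        (le_minNorm ⟨_, prodHom π.hom p.1.hom⟩ p.2 y)
      rw [inner_prodHom_algAssoc]
      refine (norm_inner_le_norm _ _).trans ?_
      have h := ContinuousLinearMap.le_opNorm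
        (repTensor (prodHom π.hom p.1.hom) p.2.hom y) (tripleL w)
      have h2 := mul_le_mul_of_nonneg_left h (norm_nonneg (tripleL v))
      refine h2.trans (le_of_eq ?_)
      simp only [LinearIsometry.norm_map]
      ring

@[simp] lemma assoc_tmul (a : A) (b : B) (c : C) :
    assoc (tmul (tmul a b) c) = tmul a (tmul b c) := by
  rw [assoc, lift_tmul, algAssoc_tmul, map_tmul, inr_apply, inr_apply, inl_apply, tmul_mul,
    tmul_mul, mul_one, mul_one, one_mul]
  rfl

/-- The associativity isomorphism in the other direction, `A ⊗ (B ⊗ C) → (A ⊗ B) ⊗ C`. -/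
def assocSymm : A ⊗ₘ (B ⊗ₘ C) →⋆ₐ[ℂ] (A ⊗ₘ B) ⊗ₘ C :=
  ((map flip (StarAlgHom.id ℂ C)).comp flip).comp
    (assoc.comp ((map flip (StarAlgHom.id ℂ A)).comp flip))

@[simp] lemma assocSymm_tmul (a : A) (b : B) (c : C) :
    assocSymm (tmul a (tmul b c)) = tmul (tmul a b) c := by
  simp only [assocSymm, StarAlgHom.comp_apply, flip_tmul, map_tmul, assoc_tmul]
  rfl

end assoc

/-- The map `id ⊗ σ ⊗ id : A ⊗ B ⊗ C ⊗ D → A ⊗ C ⊗ B ⊗ D`, where `σ : B ⊗ C → C ⊗ B` is the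
flip. -/
def idFlipId : (A ⊗ₘ B) ⊗ₘ (C ⊗ₘ D) →⋆ₐ[ℂ] (A ⊗ₘ C) ⊗ₘ (B ⊗ₘ D) :=
  assocSymm.comp <|
    (map (StarAlgHom.id ℂ A)
      (assoc.comp ((map flip (StarAlgHom.id ℂ D)).comp assocSymm))).comp assoc

@[simp] lemma idFlipId_tmul (a : A) (b : B) (c : C) (d : D) :
    idFlipId (tmul (tmul a b) (tmul c d)) = tmul (tmul a c) (tmul b d) := by
  simp only [idFlipId, StarAlgHom.comp_apply, flip_tmul, map_tmul, assoc_tmul, assocSymm_tmul]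
  rfl

section mulHom

variable {X : Type u} [TopologicalSpace X] [CompactSpace X]

/-- The multiplication `C(X) ⊗ C(X) → C(X)` on the algebraic tensor product. -/
def algMul : C(X, ℂ) ⊗[ℂ] C(X, ℂ) →⋆ₐ[ℂ] C(X, ℂ) :=
  algLift (StarAlgHom.id ℂ _) (StarAlgHom.id ℂ _) fun _ _ => Commute.all _ _

lemma algMul_tmul (f g : C(X, ℂ)) : algMul (f ⊗ₜ g) = f * g := rfl

/-- The one-dimensional representation of `C(X)` given by evaluation at a point. -/
def evalRep (k : X) : C(X, ℂ) →⋆ₐ[ℂ]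
    (EuclideanSpace ℂ PUnit.{u + 1} →L[ℂ] EuclideanSpace ℂ PUnit.{u + 1}) where
  toFun f := algebraMap ℂ _ (f k)
  map_one' := map_one (algebraMap ℂ _)
  map_mul' f g := map_mul (algebraMap ℂ _) (f k) (g k)
  map_zero' := map_zero (algebraMap ℂ _)
  map_add' f g := map_add (algebraMap ℂ _) (f k) (g k)
  commutes' _ := rfl
  map_star' f := algebraMap_star_comm (f k)

lemma evalRep_apply (k : X) (f : C(X, ℂ)) (v : EuclideanSpace ℂ PUnit.{u + 1}) :
    evalRep k f v = f k • v := by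
  change algebraMap ℂ (EuclideanSpace ℂ PUnit.{u + 1} →L[ℂ] EuclideanSpace ℂ PUnit.{u + 1}) (f k) v
    = _
  rw [Algebra.algebraMap_eq_smul_one, smul_apply, one_apply_eq_self]

lemma repTensor_evalRep (k : X) (x : C(X, ℂ) ⊗[ℂ] C(X, ℂ))
    (v : EuclideanSpace ℂ PUnit.{u + 1} ⊗[ℂ] EuclideanSpace ℂ PUnit.{u + 1}) :
    repTensor (evalRep k) (evalRep k) x (HilbertTensor.of v) =
      algMul x k • HilbertTensor.of v := by
  induction x with
  | zero => simp only [map_zero, zero_apply, ContinuousMap.zero_apply, zero_smul]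
  | add x y hx hy => simp only [map_add, add_apply, ContinuousMap.add_apply, add_smul, hx, hy]
  | tmul f g =>
    rw [repTensor_tmul, opTensor_of, algMul_tmul, ContinuousMap.mul_apply]
    rw [← map_smul]
    congr 1
    induction v with
    | zero => simp
    | add x y hx hy => rw [map_add, hx, hy, smul_add]
    | tmul u w =>
      change (evalRep k f u) ⊗ₜ[ℂ] (evalRep k g w) = _
      rw [evalRep_apply, evalRep_apply, TensorProduct.smul_tmul_smul]

/-- The multiplication map `μ : C(X) ⊗ C(X) → C(X)`. -/
def mulHom : C(X, ℂ) ⊗ₘ C(X, ℂ) →⋆ₐ[ℂ] C(X, ℂ) :=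
  lift algMul fun x => by
    rw [ContinuousMap.norm_le _ (minNorm_nonneg x)]
    intro k
    let δ : EuclideanSpace ℂ PUnit.{u + 1} := EuclideanSpace.single PUnit.unit 1
    have h1 : ‖HilbertTensor.of (δ ⊗ₜ[ℂ] δ)‖ = 1 := by
      rw [LinearIsometry.norm_map, TensorProduct.norm_tmul]
      simp [δ]
    have h := ((repTensor (evalRep k) (evalRep k) x).le_opNorm
      (HilbertTensor.of (δ ⊗ₜ[ℂ] δ))).trans (mul_le_mul_of_nonneg_right
        (le_minNorm ⟨_, evalRep k⟩ ⟨_, evalRep k⟩ x) (norm_nonneg _))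
    rwa [repTensor_evalRep, norm_smul, h1, mul_one, mul_one] at h

@[simp] lemma mulHom_tmul (f g : C(X, ℂ)) : mulHom (tmul f g) = f * g := by
  rw [mulHom, lift_tmul, algMul_tmul]

end mulHom

end MinTensor

end MinTensor

section QuantumFamilies

open MinTensor

variable {A X Y E : Type u} [CStarAlgebra A] [CStarAlgebra X] [CStarAlgebra Y] [CStarAlgebra E]

/-- A unital `*`-homomorphism `Δ : A → A ⊗ A` is coassociative if
`(Δ ⊗ id) ∘ Δ = (id ⊗ Δ) ∘ Δ` (as maps to `A ⊗ (A ⊗ A) = (A ⊗ A) ⊗ A`). A compact quantum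
semigroup is a unital C*-algebra together with a coassociative comultiplication. -/
def IsCoassociative (Δ : A →⋆ₐ[ℂ] A ⊗ₘ A) : Prop :=
  assoc.comp ((map Δ (StarAlgHom.id ℂ A)).comp Δ) = (map (StarAlgHom.id ℂ A) Δ).comp Δ

/-- A quantum family of maps `Φ : C(Y) → C(X) ⊗ C(E)` is the quantum family of all maps if every
quantum family of maps `Ψ : C(Y) → C(X) ⊗ C(D)` is `(id ⊗ Λ) ∘ Φ` for a unique unital
`*`-homomorphism `Λ : C(E) → C(D)`. The parameters `X`, `Y`, `E` stand for the unital C*-algebras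
`C(X)`, `C(Y)`, `C(E)` that define the compact quantum spaces. -/
def IsFamilyOfAllMaps (Φ : Y →⋆ₐ[ℂ] X ⊗ₘ E) : Prop :=
  ∀ (D : Type u) [CStarAlgebra D] (Ψ : Y →⋆ₐ[ℂ] X ⊗ₘ D),
    ∃! Λ : E →⋆ₐ[ℂ] D, (map (StarAlgHom.id ℂ X) Λ).comp Φ = Ψ

/-- The composite `(μ ⊗ id ⊗ id) ∘ (id ⊗ σ ⊗ id) ∘ (Φ ⊗ Φ) ∘ ΔS` from `C(S)` to
`C(K) ⊗ C(H) ⊗ C(H)`, where `σ : C(H) ⊗ C(K) → C(K) ⊗ C(H)` is the flip and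
`μ : C(K) ⊗ C(K) → C(K)` is the multiplication. -/
def pointwiseComposite {K S H : Type u} [TopologicalSpace K] [CompactSpace K] [CStarAlgebra S]
    [CStarAlgebra H] (ΔS : S →⋆ₐ[ℂ] S ⊗ₘ S) (Φ : S →⋆ₐ[ℂ] C(K, ℂ) ⊗ₘ H) :
    S →⋆ₐ[ℂ] C(K, ℂ) ⊗ₘ (H ⊗ₘ H) :=
  (map mulHom (StarAlgHom.id ℂ (H ⊗ₘ H))).comp (idFlipId.comp ((map Φ Φ).comp ΔS))

end QuantumFamilies

end QuantumMaps

end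

/-!
Existence and uniqueness of `ΔH` are the universal property of `Φ`, applied to the quantum family
`pointwiseComposite ΔS Φ`, whose algebra of parameters is `H ⊗ₘ H`.

For coassociativity write `m = (μ ⊗ id) ∘ (id ⊗ σ ⊗ id)`, the map `pointwiseMul` that multiplies
the two legs in `C(K)`, so that `(id ⊗ ΔH) ∘ Φ = m ∘ (Φ ⊗ Φ) ∘ ΔS`. By the uniqueness part of the
universal property it is enough that the two iterated comultiplications of `H` agree after
`(id ⊗ -) ∘ Φ`. Since `m` is natural in its legs outside `C(K)` (`map_comp_pointwiseMul`), these
composites are, up to rebracketing, `m ∘ (m ⊗ id)` and `m ∘ (id ⊗ m)` applied to the two iterated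
comultiplications of `S` followed by `Φ ⊗ Φ ⊗ Φ`. They agree because `ΔS` is coassociative and
because `m` is associative (`pointwiseMul_assoc`), which in turn is associativity of the product
of `C(K)`. Identities between `*`-homomorphisms on iterated minimal tensor products are checked on
elementary tensors.
-/

namespace QuantumMaps

namespace MinTensor

section Ext

variable {A B C D E F G : Type u} [CStarAlgebra A] [CStarAlgebra B] [CStarAlgebra C]
  [CStarAlgebra D] [CStarAlgebra E] [CStarAlgebra F] [CStarAlgebra G]

lemma tmul_one_one : tmul (1 : A) (1 : B) = 1 := map_one (inl : A →⋆ₐ[ℂ] A ⊗ₘ B)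

/-- Unital `*`-homomorphisms on `A ⊗ B` that agree on `A ⊗ 1` and on `1 ⊗ B` are equal. -/
lemma hom_ext_inl_inr {f g : A ⊗ₘ B →⋆ₐ[ℂ] D} (hl : f.comp inl = g.comp inl)
    (hr : f.comp inr = g.comp inr) : f = g := by
  refine hom_ext fun a b => ?_
  rw [← inl_mul_inr, map_mul, map_mul]
  exact congrArg₂ (· * ·) (DFunLike.congr_fun hl a) (DFunLike.congr_fun hr b)

lemma hom_ext₄ {f g : (A ⊗ₘ B) ⊗ₘ (C ⊗ₘ D) →⋆ₐ[ℂ] G}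
    (h : ∀ a b c d, f (tmul (tmul a b) (tmul c d)) = g (tmul (tmul a b) (tmul c d))) : f = g := by
  refine hom_ext_inl_inr (hom_ext fun a b => ?_) (hom_ext fun c d => ?_)
  · simpa only [tmul_one_one, StarAlgHom.comp_apply, inl_apply] using h a b 1 1
  · simpa only [tmul_one_one, StarAlgHom.comp_apply, inr_apply] using h 1 1 c d

lemma hom_ext₆ {f g : ((A ⊗ₘ B) ⊗ₘ (C ⊗ₘ D)) ⊗ₘ (E ⊗ₘ F) →⋆ₐ[ℂ] G}
    (h : ∀ a b c d x y, f (tmul (tmul (tmul a b) (tmul c d)) (tmul x y)) =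
      g (tmul (tmul (tmul a b) (tmul c d)) (tmul x y))) : f = g := by
  refine hom_ext_inl_inr (hom_ext₄ fun a b c d => ?_) (hom_ext fun x y => ?_)
  · simpa only [tmul_one_one, StarAlgHom.comp_apply, inl_apply] using h a b c d 1 1
  · simpa only [tmul_one_one, StarAlgHom.comp_apply, inr_apply] using h 1 1 1 1 x y

end Ext

section Functoriality

variable {A A' A'' B B' B'' C C' : Type u} [CStarAlgebra A] [CStarAlgebra A'] [CStarAlgebra A'']
  [CStarAlgebra B] [CStarAlgebra B'] [CStarAlgebra B''] [CStarAlgebra C] [CStarAlgebra C']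

lemma map_id_id :
    map (StarAlgHom.id ℂ A) (StarAlgHom.id ℂ B) = StarAlgHom.id ℂ (A ⊗ₘ B) :=
  hom_ext fun a b => by simp only [map_tmul, StarAlgHom.coe_id, id_eq]

lemma map_comp_map (f' : A' →⋆ₐ[ℂ] A'') (g' : B' →⋆ₐ[ℂ] B'') (f : A →⋆ₐ[ℂ] A')
    (g : B →⋆ₐ[ℂ] B') : (map f' g').comp (map f g) = map (f'.comp f) (g'.comp g) :=
  hom_ext fun a b => by simp only [StarAlgHom.comp_apply, map_tmul]

lemma assoc_comp_map (f : A →⋆ₐ[ℂ] A') (g : B →⋆ₐ[ℂ] B') (h : C →⋆ₐ[ℂ] C') :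
    assoc.comp (map (map f g) h) = (map f (map g h)).comp assoc := by
  refine hom_ext_inl_inr (hom_ext fun a b => ?_) (StarAlgHom.ext fun c => ?_)
  · simp only [StarAlgHom.comp_apply, inl_apply, map_tmul, assoc_tmul]
  · simp only [StarAlgHom.comp_apply, inr_apply, ← tmul_one_one (A := A) (B := B), map_tmul,
      assoc_tmul]

end Functoriality

section PointwiseMul

variable {K : Type u} [TopologicalSpace K] [CompactSpace K]
  {A A' B B' C : Type u} [CStarAlgebra A] [CStarAlgebra A'] [CStarAlgebra B] [CStarAlgebra B']
  [CStarAlgebra C]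

/-- The map `(μ ⊗ id ⊗ id) ∘ (id ⊗ σ ⊗ id)`, which multiplies the two legs in `C(K)` and keeps
the other two: `(f ⊗ a) ⊗ (g ⊗ b) ↦ f g ⊗ (a ⊗ b)`. -/
noncomputable def pointwiseMul : (C(K, ℂ) ⊗ₘ A) ⊗ₘ (C(K, ℂ) ⊗ₘ B) →⋆ₐ[ℂ] C(K, ℂ) ⊗ₘ (A ⊗ₘ B) :=
  (map mulHom (StarAlgHom.id ℂ (A ⊗ₘ B))).comp idFlipId

@[simp] lemma pointwiseMul_tmul (f g : C(K, ℂ)) (a : A) (b : B) :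
    pointwiseMul (tmul (tmul f a) (tmul g b)) = tmul (f * g) (tmul a b) := by
  simp only [pointwiseMul, StarAlgHom.comp_apply, idFlipId_tmul, map_tmul, mulHom_tmul,
    StarAlgHom.coe_id, id_eq]

/-- Naturality of `pointwiseMul` in the legs outside `C(K)`. -/
lemma map_comp_pointwiseMul (f : A →⋆ₐ[ℂ] A') (g : B →⋆ₐ[ℂ] B') :
    (map (StarAlgHom.id ℂ C(K, ℂ)) (map f g)).comp pointwiseMul =
      pointwiseMul.comp (map (map (StarAlgHom.id ℂ C(K, ℂ)) f)
        (map (StarAlgHom.id ℂ C(K, ℂ)) g)) :=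
  hom_ext₄ fun a b c d => by
    simp only [StarAlgHom.comp_apply, pointwiseMul_tmul, map_tmul, StarAlgHom.coe_id, id_eq]

/-- Associativity of `pointwiseMul`, inherited from the product of `C(K)`. -/
lemma pointwiseMul_assoc :
    (map (StarAlgHom.id ℂ C(K, ℂ)) assoc).comp (pointwiseMul.comp
        (map pointwiseMul (StarAlgHom.id ℂ (C(K, ℂ) ⊗ₘ C)))) =
      pointwiseMul.comp ((map (StarAlgHom.id ℂ (C(K, ℂ) ⊗ₘ A)) pointwiseMul).comp
        (assoc (B := C(K, ℂ) ⊗ₘ B))) :=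
  hom_ext₆ fun a b c d x y => by
    simp only [StarAlgHom.comp_apply, pointwiseMul_tmul, map_tmul, assoc_tmul,
      StarAlgHom.coe_id, id_eq, mul_assoc]

end PointwiseMul

end MinTensor

section Coassociativity

open MinTensor

variable {K S H : Type u} [TopologicalSpace K] [CompactSpace K] [CStarAlgebra S] [CStarAlgebra H]
  {ΔS : S →⋆ₐ[ℂ] S ⊗ₘ S} {Φ : S →⋆ₐ[ℂ] C(K, ℂ) ⊗ₘ H} {ΔH : H →⋆ₐ[ℂ] H ⊗ₘ H}

lemma pointwiseComposite_eq :
    pointwiseComposite ΔS Φ = pointwiseMul.comp ((map Φ Φ).comp ΔS) := rfl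

/-- A further pair of `*`-homomorphisms after `ΔH` can be moved inside the pointwise product. -/
lemma map_map_comp_comp {A B : Type u} [CStarAlgebra A] [CStarAlgebra B]
    (h : (map (StarAlgHom.id ℂ C(K, ℂ)) ΔH).comp Φ = pointwiseComposite ΔS Φ)
    (f : H →⋆ₐ[ℂ] A) (g : H →⋆ₐ[ℂ] B) :
    (map (StarAlgHom.id ℂ C(K, ℂ)) ((map f g).comp ΔH)).comp Φ =
      pointwiseMul.comp ((map ((map (StarAlgHom.id ℂ C(K, ℂ)) f).comp Φ)
        ((map (StarAlgHom.id ℂ C(K, ℂ)) g).comp Φ)).comp ΔS) := by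
  have h1 : map (StarAlgHom.id ℂ C(K, ℂ)) ((map f g).comp ΔH) =
      (map (StarAlgHom.id ℂ C(K, ℂ)) (map f g)).comp (map (StarAlgHom.id ℂ C(K, ℂ)) ΔH) := by
    rw [map_comp_map, StarAlgHom.id_comp]
  rw [h1, StarAlgHom.comp_assoc, h, pointwiseComposite_eq, ← StarAlgHom.comp_assoc,
    map_comp_pointwiseMul, ← map_comp_map]
  simp only [StarAlgHom.comp_assoc]

/-- The two iterated comultiplications of `H` define the same quantum family of maps. -/
lemma map_assoc_comp_eq (hS : IsCoassociative ΔS)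
    (h : (map (StarAlgHom.id ℂ C(K, ℂ)) ΔH).comp Φ = pointwiseComposite ΔS Φ) :
    (map (StarAlgHom.id ℂ C(K, ℂ))
        (assoc.comp ((map ΔH (StarAlgHom.id ℂ H)).comp ΔH))).comp Φ =
      (map (StarAlgHom.id ℂ C(K, ℂ)) ((map (StarAlgHom.id ℂ H) ΔH).comp ΔH)).comp Φ := by
  have hl : map (StarAlgHom.id ℂ C(K, ℂ)) (assoc.comp ((map ΔH (StarAlgHom.id ℂ H)).comp ΔH)) =
      (map (StarAlgHom.id ℂ C(K, ℂ)) assoc).comp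
        (map (StarAlgHom.id ℂ C(K, ℂ)) ((map ΔH (StarAlgHom.id ℂ H)).comp ΔH)) := by
    rw [map_comp_map, StarAlgHom.id_comp]
  have hL : map (pointwiseMul.comp ((map Φ Φ).comp ΔS)) Φ =
      (map pointwiseMul (StarAlgHom.id ℂ _)).comp
        ((map (map Φ Φ) Φ).comp (map ΔS (StarAlgHom.id ℂ S))) := by
    rw [map_comp_map, map_comp_map, StarAlgHom.id_comp, StarAlgHom.comp_id]
  have hR : map Φ (pointwiseMul.comp ((map Φ Φ).comp ΔS)) =
      (map (StarAlgHom.id ℂ _) pointwiseMul).comp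
        ((map Φ (map Φ Φ)).comp (map (StarAlgHom.id ℂ S) ΔS)) := by
    rw [map_comp_map, map_comp_map, StarAlgHom.id_comp, StarAlgHom.comp_id]
  rw [hl, StarAlgHom.comp_assoc, map_map_comp_comp h, map_map_comp_comp h, h, map_id_id,
    StarAlgHom.id_comp, pointwiseComposite_eq, hL, hR]
  calc _ = ((map (StarAlgHom.id ℂ C(K, ℂ)) assoc).comp (pointwiseMul.comp
          (map pointwiseMul (StarAlgHom.id ℂ (C(K, ℂ) ⊗ₘ H))))).comp
        ((map (map Φ Φ) Φ).comp ((map ΔS (StarAlgHom.id ℂ S)).comp ΔS)) := by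
        simp only [StarAlgHom.comp_assoc]
    _ = pointwiseMul.comp ((map (StarAlgHom.id ℂ (C(K, ℂ) ⊗ₘ H)) pointwiseMul).comp
        ((assoc.comp (map (map Φ Φ) Φ)).comp ((map ΔS (StarAlgHom.id ℂ S)).comp ΔS))) := by
        rw [pointwiseMul_assoc]
        simp only [StarAlgHom.comp_assoc]
    _ = _ := by
        rw [assoc_comp_map, StarAlgHom.comp_assoc, hS]
        simp only [StarAlgHom.comp_assoc]

end Coassociativity

end QuantumMaps

theorem theorem6p1 {K S H : Type u} [Finite K] [TopologicalSpace K] [DiscreteTopology K]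
    [CStarAlgebra S] [CStarAlgebra H]
    (ΔS : S →⋆ₐ[ℂ] S ⊗ₘ S) (hΔS : QuantumMaps.IsCoassociative ΔS)
    (Φ : S →⋆ₐ[ℂ] C(K, ℂ) ⊗ₘ H) (hΦ : QuantumMaps.IsFamilyOfAllMaps Φ) :
    ∃ ΔH : H →⋆ₐ[ℂ] H ⊗ₘ H,
      (QuantumMaps.MinTensor.map (StarAlgHom.id ℂ C(K, ℂ)) ΔH).comp Φ =
        QuantumMaps.pointwiseComposite ΔS Φ ∧
      (∀ Δ : H →⋆ₐ[ℂ] H ⊗ₘ H,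
        (QuantumMaps.MinTensor.map (StarAlgHom.id ℂ C(K, ℂ)) Δ).comp Φ =
          QuantumMaps.pointwiseComposite ΔS Φ → Δ = ΔH) ∧
      QuantumMaps.IsCoassociative ΔH := by
  obtain ⟨ΔH, h, hu⟩ := hΦ (H ⊗ₘ H) (QuantumMaps.pointwiseComposite ΔS Φ)
  exact ⟨ΔH, h, hu, (hΦ _ _).unique (QuantumMaps.map_assoc_comp_eq hΔS h) rfl⟩
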